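/- Consider a data center with $n\ge 1$ racks. Rack $i$ has exhaust temperature $T_{out,i}$, air mass $m_i>0$, air flow $f_i>0$, and consumes the power $P_i(D)=v_i+w_iD_i$ with $v_i\ge 0$, $w_i>0$ when it runs the workload $D_i$. Let $\rho,c_p>0$ be the density and specific heat of air, and let $\gamma_{ij}\ge 0$ be the fraction of the exhaust air of rack $i$ that is recirculated to rack $j$, where $(1-\sum_j\gamma_{ij})f_i>0$ and $f_i-\sum_j\gamma_{ji}f_j>0$ for all $i$. Put $\Gamma=(\gamma_{ij})$, $F=\mathrm{diag}(f)$, $W=\mathrm{diag}(w)$, $M=\mathrm{diag}(c_pm)$, $A=\rho c_pM^{-1}(\Gamma^T-I_n)F$, $B=M^{-1}W$, $V=(v_i)_i$, $P(D)=V+WD$, and let $\mathbf 1$ be the all-ones vector. Let $Z$ be symmetric positive definite with $A^TZ+ZA=-2I_n$, let $T_{safe},D_{max}\in\mathbb R^n$, and let the total workload $D^*\in\mathbb R$ be constant. Consider for $t\ge0$ the closed loop $$\dot T_{out}=A(T_{out}-\mathbf 1T_{sup})+M^{-1}P(D),\quad \dot T_{sup}=\mathbf 1^TA^TZ(T_{out}-T_{safe}),\quad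 \dot D=\Big(\frac{\mathbf 1\mathbf 1^T}{n}-I_n\Big)B^TZ(T_{out}-T_{safe}).$$ With $\kappa=\mathbf 1^TW^{-1}MA\mathbf 1$ put $$C_1^T=\frac{\mathbf 1^TW^{-1}MA}{\kappa},\quad C_2=\frac{D^*+\mathbf 1^TW^{-1}V}{\kappa},\quad C_3=-W^{-1}MA(I_n-\mathbf 1C_1^T),\quad C_4=W^{-1}MA\mathbf 1\,C_2-W^{-1}V,$$ $$\bar T_{sup}=C_1^TT_{safe}+C_2,\qquad \bar D=C_3T_{safe}+C_4 .$$ The power minimization problem is to minimize $$\frac{-\mathbf 1^TMA(T_{out}-\mathbf 1T_{sup})}{COP(T_{sup})}+\mathbf 1^TP(D)$$ over $(T_{out},T_{sup},D)$ subject to $\mathbf 1^TD=D^*$, $0\le D\le D_{max}$, $0=A(T_{out}-\mathbf 1T_{sup})+M^{-1}P(D)$, $T_{out}\le T_{safe}$ (componentwise) and $T_{sup}\in R$, where $R\subseteq\mathbb R$ is the range of operation of the supply temperature, on which $COP$ is positive and monotonically increasing. Theorem. (a) For all initial values with $\mathbf 1^TD(0)=D^*$ the closed loop has a solution on $[0,\infty)$,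 and every such solution is bounded and satisfies $T_{out}(t)\to T_{safe}$, $T_{sup}(t)\to\bar T_{sup}$, $D(t)\to\bar D$ as $t\to\infty$. (b) Let the racks be homogeneous ($v_i$ and $w_i$ do not depend on $i$). If $0\le\bar D\le D_{max}$ and $\bar T_{sup}\in R$, then $(T_{safe},\bar T_{sup},\bar D)$ is an optimal solution of the power minimization problem, and if moreover $D^*>0$ and $COP$ is strictly increasing on $R$, then it is the only one. (c) Let the racks be homogeneous and $COP$ strictly increasing on $R$. If an optimal solution $(T,\tau,D)$ has inactive workload constraints, $0<D_i<D_{max,i}$ for all $i$, and $\tau$ is an interior point of $R$, then $(T,\tau,D)=(T_{safe},\bar T_{sup},\bar D)$. In particular, if the workload constraints are inactive at the optimum, all closed-loop solutions with $\mathbf 1^TD(0)=D^*$ converge to the optimal solution. -/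

import Mathlib

open Set Filter Topology Matrix

noncomputable section

/-- The physical parameters of a data center with `n` racks.  `γ i j` is the fraction of the exhaust
air of rack `i` that is recirculated to the inlet of rack `j`; a rack `i` that runs `d` CPUs
consumes the power `v i + w i * d`. -/
structure DataCenter (n : ℕ) where
  /-- density of air -/
  ρ : ℝ
  /-- specific heat capacity of air -/
  cp : ℝ
  /-- mass of the air inside each rack -/
  m : Fin n → ℝ
  /-- air flow through each rack -/
  f : Fin n → ℝ
  /-- recirculation fractions -/
  γ : Matrix (Fin n) (Fin n) ℝ
  /-- load-independent power consumption of each rack -/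
  v : Fin n → ℝ
  /-- power consumption per CPU in use of each rack -/
  w : Fin n → ℝ

namespace DataCenter

variable {n : ℕ}

/-- The physical sign conditions: positive densities, masses, flows and power coefficients,
a positive part of the exhaust air of every rack returns to the cooling unit (CRAC), and every rack
receives a positive air flow from the cooling unit. -/
structure IsPhysical (dc : DataCenter n) : Prop where
  ρ_pos : 0 < dc.ρ
  cp_pos : 0 < dc.cp
  m_pos : ∀ i, 0 < dc.m i
  f_pos : ∀ i, 0 < dc.f i
  γ_nonneg : ∀ i j, 0 ≤ dc.γ i j
  return_pos : ∀ i, 0 < (1 - ∑ j, dc.γ i j) * dc.f i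
  supply_pos : ∀ i, 0 < dc.f i - ∑ j, dc.γ j i * dc.f j
  v_nonneg : ∀ i, 0 ≤ dc.v i
  w_pos : ∀ i, 0 < dc.w i

/-- All racks have the same power characteristics. -/
def IsHomogeneous (dc : DataCenter n) : Prop :=
  (∀ i j, dc.v i = dc.v j) ∧ (∀ i j, dc.w i = dc.w j)

/-- `M = diag(c_p m)`. -/
def M (dc : DataCenter n) : Matrix (Fin n) (Fin n) ℝ := diagonal fun i => dc.cp * dc.m i

/-- `F = diag(f)`. -/
def F (dc : DataCenter n) : Matrix (Fin n) (Fin n) ℝ := diagonal dc.f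

/-- `W = diag(w)`. -/
def W (dc : DataCenter n) : Matrix (Fin n) (Fin n) ℝ := diagonal dc.w

/-- `A = ρ c_p M⁻¹ (Γᵀ - I) F`. -/
def A (dc : DataCenter n) : Matrix (Fin n) (Fin n) ℝ :=
  (dc.ρ * dc.cp) • (dc.M⁻¹ * (dc.γᵀ - 1) * dc.F)

/-- `B = M⁻¹ W`. -/
def B (dc : DataCenter n) : Matrix (Fin n) (Fin n) ℝ := dc.M⁻¹ * dc.W

/-- The power consumption of the racks, `P(D) = V + W D`. -/
def P (dc : DataCenter n) (D : Fin n → ℝ) : Fin n → ℝ := dc.v + dc.W *ᵥ D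

/-- The right-hand side `A (T_out - 𝟙 T_sup) + M⁻¹ P(D)` of the thermal model. -/
def thermalField (dc : DataCenter n) (Tout : Fin n → ℝ) (Tsup : ℝ) (D : Fin n → ℝ) :
    Fin n → ℝ :=
  dc.A *ᵥ (Tout - Tsup • (1 : Fin n → ℝ)) + dc.M⁻¹ *ᵥ dc.P D

/-- The heat `-𝟙ᵀ M A (T_out - 𝟙 T_sup)` that the cooling unit has to remove. -/
def heatRemoved (dc : DataCenter n) (Tout : Fin n → ℝ) (Tsup : ℝ) : ℝ :=
  -((1 : Fin n → ℝ) ⬝ᵥ ((dc.M * dc.A) *ᵥ (Tout - Tsup • (1 : Fin n → ℝ))))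

/-- The total power consumption: cooling unit plus racks. -/
def cost (dc : DataCenter n) (COP : ℝ → ℝ) (Tout : Fin n → ℝ) (Tsup : ℝ) (D : Fin n → ℝ) : ℝ :=
  dc.heatRemoved Tout Tsup / COP Tsup + (1 : Fin n → ℝ) ⬝ᵥ dc.P D

/-- The constraints of the power minimization problem.  `R` is the range of operation of the supply
temperature (`R = univ` if it is not restricted). -/
structure IsFeasible (dc : DataCenter n) (R : Set ℝ) (Tsafe Dmax : Fin n → ℝ) (Dstar : ℝ)
    (Tout : Fin n → ℝ) (Tsup : ℝ) (D : Fin n → ℝ) : Prop where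
  range : Tsup ∈ R
  workload : Dstar = (1 : Fin n → ℝ) ⬝ᵥ D
  nonneg : ∀ i, 0 ≤ D i
  capacity : ∀ i, D i ≤ Dmax i
  steady : 0 = dc.thermalField Tout Tsup D
  safe : ∀ i, Tout i ≤ Tsafe i

/-- `(Tout, Tsup, D)` is an optimal solution of the power minimization problem. -/
def IsOptimal (dc : DataCenter n) (COP : ℝ → ℝ) (R : Set ℝ) (Tsafe Dmax : Fin n → ℝ) (Dstar : ℝ)
    (Tout : Fin n → ℝ) (Tsup : ℝ) (D : Fin n → ℝ) : Prop :=
  dc.IsFeasible R Tsafe Dmax Dstar Tout Tsup D ∧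
    ∀ Tout' Tsup' D', dc.IsFeasible R Tsafe Dmax Dstar Tout' Tsup' D' →
      dc.cost COP Tout Tsup D ≤ dc.cost COP Tout' Tsup' D'

/-- The scalar `𝟙ᵀ W⁻¹ M A 𝟙`. -/
def kappa (dc : DataCenter n) : ℝ :=
  (1 : Fin n → ℝ) ⬝ᵥ ((dc.W⁻¹ * dc.M * dc.A) *ᵥ (1 : Fin n → ℝ))

/-- `C₁ᵀ = 𝟙ᵀ W⁻¹ M A / (𝟙ᵀ W⁻¹ M A 𝟙)`. -/
def C₁ (dc : DataCenter n) : Fin n → ℝ :=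
  dc.kappa⁻¹ • ((1 : Fin n → ℝ) ᵥ* (dc.W⁻¹ * dc.M * dc.A))

/-- `C₂(D*) = (D* + 𝟙ᵀ W⁻¹ V) / (𝟙ᵀ W⁻¹ M A 𝟙)`. -/
def C₂ (dc : DataCenter n) (Dstar : ℝ) : ℝ :=
  (Dstar + (1 : Fin n → ℝ) ⬝ᵥ (dc.W⁻¹ *ᵥ dc.v)) / dc.kappa

/-- `C₃ = -W⁻¹ M A (I - 𝟙 C₁ᵀ)`. -/
def C₃ (dc : DataCenter n) : Matrix (Fin n) (Fin n) ℝ :=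
  -(dc.W⁻¹ * dc.M * dc.A * (1 - vecMulVec (1 : Fin n → ℝ) dc.C₁))

/-- `C₄(D*) = W⁻¹ M A 𝟙 C₂(D*) - W⁻¹ V`. -/
def C₄ (dc : DataCenter n) (Dstar : ℝ) : Fin n → ℝ :=
  dc.C₂ Dstar • ((dc.W⁻¹ * dc.M * dc.A) *ᵥ (1 : Fin n → ℝ)) - dc.W⁻¹ *ᵥ dc.v

/-- The steady-state supply temperature that belongs to the exhaust temperatures `Tout` and the
total workload `Dstar`. -/
def steadyTsup (dc : DataCenter n) (Dstar : ℝ) (Tout : Fin n → ℝ) : ℝ :=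
  dc.C₁ ⬝ᵥ Tout + dc.C₂ Dstar

/-- The steady-state workload distribution that belongs to the exhaust temperatures `Tout` and the
total workload `Dstar`. -/
def steadyD (dc : DataCenter n) (Dstar : ℝ) (Tout : Fin n → ℝ) : Fin n → ℝ :=
  dc.C₃ *ᵥ Tout + dc.C₄ Dstar

/-- `(Tout, Tsup, D)` is a solution on `[0, ∞)` of the thermal model in closed loop with the two
temperature-feedback controllers. -/
structure IsClosedLoopSolution (dc : DataCenter n) (Z : Matrix (Fin n) (Fin n) ℝ)
    (Tsafe : Fin n → ℝ) (Tout : ℝ → Fin n → ℝ) (Tsup : ℝ → ℝ) (D : ℝ → Fin n → ℝ) : Prop where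
  thermal : ∀ t, 0 ≤ t →
    HasDerivWithinAt Tout (dc.thermalField (Tout t) (Tsup t) (D t)) (Ici 0) t
  supply : ∀ t, 0 ≤ t →
    HasDerivWithinAt Tsup ((1 : Fin n → ℝ) ⬝ᵥ ((dc.Aᵀ * Z) *ᵥ (Tout t - Tsafe))) (Ici 0) t
  workload : ∀ t, 0 ≤ t →
    HasDerivWithinAt D
      (((n : ℝ)⁻¹ • vecMulVec (1 : Fin n → ℝ) (1 : Fin n → ℝ) - 1) *ᵥ
        ((dc.Bᵀ * Z) *ᵥ (Tout t - Tsafe))) (Ici 0) t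

end DataCenter

end

/-! Steady states. Since `B` is invertible, a steady state with total workload `D*` is determined by
its exhaust temperatures `T`: the balance gives `D` in terms of `T` and the supply temperature, and
the total of that `D` is affine in the supply temperature with slope `kappa < 0`. Hence
`steady_iff`: the supply temperature and `D` are affine functions of `T`.

Convergence. Let `x`, `s`, `d` be the deviations of `Tout`, `Tsup`, `D` from the setpoint, and `r =
B d - s A 𝟙`, so that `x' = A x + r`. The controllers are chosen so that `V = xᵀ Z x + s² + |d|²`
satisfies `V' = -2|x|²`. This only damps `x`, but `r' = K x` for a constant matrix `K`, so
subtracting `ε ⟨x, r⟩` also produces damping of `|r|²` (`exists_energy_le_exp`). Because the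
controllers preserve the total workload, `d` has zero total, and then `r` controls both `s` and `d`
(`exists_deviation_le`). The decay is therefore exponential, and no invariance principle is needed.

Optimality. At a steady state the heat removed equals the rack power, which for homogeneous racks
depends on `D*` only. Minimizing the cost thus means making the supply temperature as high as
possible; it increases with every exhaust temperature (`C₁_pos`), so `T = Tsafe` is best. If the
other constraints are inactive, a small move towards `Tsafe` stays feasible and improves the cost.
-/

/-! ### Quadratic estimates and exponential decay of partially damped systems. -/

section RealVectors

variable {ι κ : Type*} [Fintype ι] [Fintype κ]

theorem two_mul_abs_dotProduct_le (u v : ι → ℝ) : 2 * |u ⬝ᵥ v| ≤ u ⬝ᵥ u + v ⬝ᵥ v := by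
  have h1 : 0 ≤ (u - v) ⬝ᵥ (u - v) := by
    simpa using dotProduct_star_self_nonneg (u - v)
  have h2 : 0 ≤ (u + v) ⬝ᵥ (u + v) := by
    simpa using dotProduct_star_self_nonneg (u + v)
  simp only [sub_dotProduct, dotProduct_sub, add_dotProduct, dotProduct_add] at h1 h2
  rw [dotProduct_comm v u] at h1 h2
  have : |u ⬝ᵥ v| ≤ (u ⬝ᵥ u + v ⬝ᵥ v) / 2 := abs_le.2 ⟨by linarith, by linarith⟩
  linarith

theorem dotProduct_self_nonneg' (u : ι → ℝ) : 0 ≤ u ⬝ᵥ u := by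
  simpa using dotProduct_star_self_nonneg u

theorem dotProduct_sq_le (u v : ι → ℝ) : (u ⬝ᵥ v) ^ 2 ≤ (u ⬝ᵥ u) * (v ⬝ᵥ v) := by
  simpa [dotProduct, sq] using Finset.sum_mul_sq_le_sq_mul_sq Finset.univ u v

/-- Cauchy–Schwarz in each row; the constant is the squared Frobenius norm. -/
theorem exists_mulVec_dotProduct_mulVec_le (K : Matrix κ ι ℝ) :
    ∃ C, 0 ≤ C ∧ ∀ x, (K *ᵥ x) ⬝ᵥ (K *ᵥ x) ≤ C * (x ⬝ᵥ x) := by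
  refine ⟨∑ i, K i ⬝ᵥ K i, Finset.sum_nonneg fun i _ => dotProduct_self_nonneg' _, fun x => ?_⟩
  rw [Finset.sum_mul]
  refine Finset.sum_le_sum fun i _ => ?_
  rw [← sq]
  exact dotProduct_sq_le _ _

/-- Passes from the Euclidean energy to the sup norm that `ι → ℝ` carries. -/
theorem norm_sq_le_dotProduct_self (x : ι → ℝ) : ‖x‖ ^ 2 ≤ x ⬝ᵥ x := by
  have h : ‖x‖ ≤ √(x ⬝ᵥ x) := by
    refine (pi_norm_le_iff_of_nonneg (Real.sqrt_nonneg _)).2 fun i => ?_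
    refine Real.le_sqrt_of_sq_le ?_
    rw [Real.norm_eq_abs, sq_abs, sq]
    exact Finset.single_le_sum (f := fun j => x j * x j) (fun j _ => mul_self_nonneg _)
      (Finset.mem_univ i)
  calc ‖x‖ ^ 2 ≤ √(x ⬝ᵥ x) ^ 2 := by gcongr
    _ = x ⬝ᵥ x := Real.sq_sqrt (dotProduct_self_nonneg' x)

/-- Coercivity without eigenvalues: expand the form of `Z` at `(1 + C) x - Z⁻¹ x`, where `C` bounds
`Z⁻¹`. The cross terms give `-2 (1 + C) |x|²`, and `⟨x, Z⁻¹ x⟩` takes back at most a quarter of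
that. -/
theorem Matrix.PosDef.exists_dotProduct_self_le [DecidableEq ι] {Z : Matrix ι ι ℝ}
    (hZ : Z.PosDef) : ∃ C, 0 ≤ C ∧ ∀ x, x ⬝ᵥ x ≤ C * (x ⬝ᵥ (Z *ᵥ x)) := by
  obtain ⟨C, hC, h⟩ := exists_mulVec_dotProduct_mulVec_le Z⁻¹
  have hq : ∀ x, 0 ≤ x ⬝ᵥ (Z *ᵥ x) := fun x => by
    simpa using hZ.posSemidef.dotProduct_mulVec_nonneg x
  have hsymm : ∀ x y, x ⬝ᵥ (Z *ᵥ y) = y ⬝ᵥ (Z *ᵥ x) := fun x y => by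
    have hT : Zᵀ = Z := by simpa [IsHermitian] using hZ.isHermitian
    rw [dotProduct_mulVec, ← mulVec_transpose, hT, dotProduct_comm]
  have hZi : ∀ x, Z *ᵥ (Z⁻¹ *ᵥ x) = x := fun x => by
    rw [mulVec_mulVec, mul_nonsing_inv _ ((isUnit_iff_isUnit_det _).1 hZ.isUnit), one_mulVec]
  refine ⟨1 + C, by positivity, fun x => ?_⟩
  have h1 := hq ((1 + C) • x - Z⁻¹ *ᵥ x)
  have h2 : x ⬝ᵥ (Z⁻¹ *ᵥ x) ≤ (1 + C) / 2 * (x ⬝ᵥ x) := by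
    have := two_mul_abs_dotProduct_le x (Z⁻¹ *ᵥ x)
    have := le_abs_self (x ⬝ᵥ (Z⁻¹ *ᵥ x))
    have := h x
    linarith
  simp only [mulVec_sub, dotProduct_sub, sub_dotProduct, mulVec_smul, smul_dotProduct,
    dotProduct_smul, hZi, smul_eq_mul] at h1
  rw [hsymm (Z⁻¹ *ᵥ x) x, hZi, dotProduct_comm (Z⁻¹ *ᵥ x) x] at h1
  have hC1 : 0 < 1 + C := by positivity
  have h3 : 0 ≤ (1 + C) * ((1 + C) * (x ⬝ᵥ (Z *ᵥ x)) - 3 / 2 * (x ⬝ᵥ x)) := by linarith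
  have h4 := nonneg_of_mul_nonneg_right h3 hC1
  have := dotProduct_self_nonneg' x
  linarith

theorem HasDerivWithinAt.dotProduct {u v : ℝ → ι → ℝ} {u' v' : ι → ℝ} {s : Set ℝ} {t : ℝ}
    (hu : HasDerivWithinAt u u' s t) (hv : HasDerivWithinAt v v' s t) :
    HasDerivWithinAt (fun t => u t ⬝ᵥ v t) (u' ⬝ᵥ v t + u t ⬝ᵥ v') s t := by
  simp only [_root_.dotProduct, ← Finset.sum_add_distrib]
  exact HasDerivWithinAt.fun_sum fun i _ =>
    (hasDerivWithinAt_pi.1 hu i).mul (hasDerivWithinAt_pi.1 hv i)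

theorem HasDerivWithinAt.matrix_mulVec (K : Matrix κ ι ℝ) {u : ℝ → ι → ℝ} {u' : ι → ℝ}
    {s : Set ℝ} {t : ℝ} (hu : HasDerivWithinAt u u' s t) :
    HasDerivWithinAt (fun t => K *ᵥ u t) (K *ᵥ u') s t :=
  (K.mulVecLin.toContinuousLinearMap.hasFDerivAt (x := u t)).comp_hasDerivWithinAt t hu

/-- A differential inequality `U' ≤ -c U` on `[0, ∞)` forces exponential decay. -/
theorem le_mul_exp_of_hasDerivWithinAt_le {U U' : ℝ → ℝ} {c : ℝ}
    (hU : ∀ t, 0 ≤ t → HasDerivWithinAt U (U' t) (Ici 0) t)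
    (hle : ∀ t, 0 ≤ t → U' t ≤ -c * U t) {t : ℝ} (ht : 0 ≤ t) :
    U t ≤ U 0 * Real.exp (-c * t) := by
  have hd : ∀ t, 0 ≤ t → HasDerivWithinAt (fun t => U t * Real.exp (c * t))
      ((U' t + c * U t) * Real.exp (c * t)) (Ici 0) t := fun t ht => by
    have h := (hU t ht).mul (((hasDerivAt_id t).const_mul c).exp.hasDerivWithinAt (s := Ici 0))
    refine h.congr_deriv ?_
    simp only [id]
    ring
  have hd' : ∀ t ∈ interior (Ici (0 : ℝ)), HasDerivAt (fun t => U t * Real.exp (c * t))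
      ((U' t + c * U t) * Real.exp (c * t)) t := fun t ht => by
    rw [interior_Ici] at ht
    exact (hd t (le_of_lt ht)).hasDerivAt (Ici_mem_nhds ht)
  have hanti : AntitoneOn (fun t => U t * Real.exp (c * t)) (Ici 0) := by
    refine antitoneOn_of_deriv_nonpos (convex_Ici 0)
      (fun t ht => (hd t ht).continuousWithinAt)
      (fun t ht => (hd' t ht).differentiableAt.differentiableWithinAt) fun t ht => ?_
    rw [(hd' t ht).deriv]
    have := hle t (interior_subset ht)
    exact mul_nonpos_of_nonpos_of_nonneg (by linarith) (Real.exp_pos _).le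
  have h := hanti self_mem_Ici ht ht
  simp only [mul_zero, Real.exp_zero, mul_one] at h
  calc U t = U t * Real.exp (c * t) * Real.exp (-c * t) := by
        rw [mul_assoc, ← Real.exp_add]; simp
    _ ≤ _ := by gcongr

/-- Exponential decay of a partially damped system `x' = A x + r`, `r' = K x` whose energy `V`
dissipates at the rate `V' = -2 |x|²`.  The strict Lyapunov function is `V - ε ⟨x, r⟩`. -/
theorem exists_energy_le_exp (A K : Matrix ι ι ℝ) {x r : ℝ → ι → ℝ} {V : ℝ → ℝ} {a b : ℝ}
    (ha : 0 ≤ a) (hb : 0 ≤ b)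
    (hx : ∀ t, 0 ≤ t → HasDerivWithinAt x (A *ᵥ x t + r t) (Ici 0) t)
    (hr : ∀ t, 0 ≤ t → HasDerivWithinAt r (K *ᵥ x t) (Ici 0) t)
    (hV : ∀ t, 0 ≤ t → HasDerivWithinAt V (-2 * (x t ⬝ᵥ x t)) (Ici 0) t)
    (hV0 : ∀ t, 0 ≤ t → 0 ≤ V t)
    (hlow : ∀ t, 0 ≤ t → x t ⬝ᵥ x t + r t ⬝ᵥ r t ≤ a * V t)
    (hup : ∀ t, 0 ≤ t → V t ≤ b * (x t ⬝ᵥ x t + r t ⬝ᵥ r t)) :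
    ∃ C c, 0 ≤ C ∧ 0 < c ∧ ∀ t, 0 ≤ t → V t ≤ C * Real.exp (-c * t) := by
  obtain ⟨α, hα, hA⟩ := exists_mulVec_dotProduct_mulVec_le A
  obtain ⟨β, hβ, hK⟩ := exists_mulVec_dotProduct_mulVec_le K
  -- `ε a ≤ 1` keeps the modified energy between `V / 2` and `3 V / 2`; `ε (1 + α + β) ≤ 1` lets `-2
  -- |x|²` absorb the `|x|²` terms from the derivative of the cross term.
  obtain ⟨ε, hε, hεa, hεC⟩ : ∃ ε : ℝ, 0 < ε ∧ ε * a ≤ 1 ∧ ε * (1 + α + β) ≤ 1 := by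
    refine ⟨1 / (1 + a + α + β), by positivity, ?_, ?_⟩
    · rw [div_mul_eq_mul_div, div_le_one (by positivity)]; linarith
    · rw [div_mul_eq_mul_div, div_le_iff₀ (by positivity)]; linarith
  have hε1 : ε ≤ 1 := le_trans (le_mul_of_one_le_right hε.le (by linarith)) hεC
  have hcross : ∀ t, 0 ≤ t → |ε * (x t ⬝ᵥ r t)| ≤ V t / 2 := fun t ht => by
    rw [abs_mul, abs_of_pos hε]
    have h1 : ε * (2 * |x t ⬝ᵥ r t|) ≤ ε * (a * V t) :=
      mul_le_mul_of_nonneg_left ((two_mul_abs_dotProduct_le _ _).trans (hlow t ht)) hε.le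
    have h2 : ε * a * V t ≤ 1 * V t := mul_le_mul_of_nonneg_right hεa (hV0 t ht)
    linarith
  have hU : ∀ t, 0 ≤ t → HasDerivWithinAt (fun t => V t - ε * (x t ⬝ᵥ r t))
      (-2 * (x t ⬝ᵥ x t) - ε * ((A *ᵥ x t + r t) ⬝ᵥ r t + x t ⬝ᵥ (K *ᵥ x t))) (Ici 0) t :=
    fun t ht => (hV t ht).sub (((hx t ht).dotProduct (hr t ht)).const_mul ε)
  -- The modified energy is at most `(3 / 2) b (|x|² + |r|²)` and decreases at least at rate `(ε /
  -- 2) (|x|² + |r|²)`; `b + 1` replaces `b` to avoid division by zero.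
  have hdecay := fun t (ht : 0 ≤ t) => le_mul_exp_of_hasDerivWithinAt_le (c := ε / (3 * (b + 1))) hU
    (fun t ht => by
      have h1 : -((A *ᵥ x t) ⬝ᵥ r t) ≤ (α * (x t ⬝ᵥ x t) + r t ⬝ᵥ r t) / 2 := by
        have := two_mul_abs_dotProduct_le (A *ᵥ x t) (r t)
        have := neg_abs_le ((A *ᵥ x t) ⬝ᵥ r t)
        have := hA (x t)
        linarith
      have h2 : -(x t ⬝ᵥ (K *ᵥ x t)) ≤ (1 + β) * (x t ⬝ᵥ x t) / 2 := by
        have := two_mul_abs_dotProduct_le (x t) (K *ᵥ x t)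
        have := neg_abs_le (x t ⬝ᵥ (K *ᵥ x t))
        have := hK (x t)
        linarith
      have hxx := dotProduct_self_nonneg' (x t)
      have h3 : ε * (-((A *ᵥ x t) ⬝ᵥ r t) - x t ⬝ᵥ (K *ᵥ x t)) ≤
          ε * ((α * (x t ⬝ᵥ x t) + r t ⬝ᵥ r t) / 2 + (1 + β) * (x t ⬝ᵥ x t) / 2) :=
        mul_le_mul_of_nonneg_left (by linarith) hε.le
      have h4 : ε * (1 + α + β) * (x t ⬝ᵥ x t) ≤ 1 * (x t ⬝ᵥ x t) :=
        mul_le_mul_of_nonneg_right hεC hxx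
      have h5 : ε * (x t ⬝ᵥ x t) ≤ 1 * (x t ⬝ᵥ x t) := mul_le_mul_of_nonneg_right hε1 hxx
      have h6 := (abs_le.1 (hcross t ht)).1
      have h7 : ε / (3 * (b + 1)) * (V t - ε * (x t ⬝ᵥ r t)) ≤
          ε / 2 * (x t ⬝ᵥ x t + r t ⬝ᵥ r t) := by
        have hS : 0 ≤ x t ⬝ᵥ x t + r t ⬝ᵥ r t :=
          add_nonneg hxx (dotProduct_self_nonneg' _)
        calc ε / (3 * (b + 1)) * (V t - ε * (x t ⬝ᵥ r t))
            ≤ ε / (3 * (b + 1)) * (3 / 2 * ((b + 1) * (x t ⬝ᵥ x t + r t ⬝ᵥ r t))) := by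
              gcongr
              have := hup t ht
              linarith
          _ = ε / 2 * (x t ⬝ᵥ x t + r t ⬝ᵥ r t) := by
              have : b + 1 ≠ 0 := by positivity
              field_simp
      rw [add_dotProduct]
      linarith) ht
  refine ⟨2 * (V 0 - ε * (x 0 ⬝ᵥ r 0)), ε / (3 * (b + 1)), ?_, by positivity, fun t ht => ?_⟩
  · have := (abs_le.1 (hcross 0 le_rfl)).2
    have := hV0 0 le_rfl
    linarith
  · have := (abs_le.1 (hcross t ht)).2
    have := hdecay t ht
    linarith

end RealVectors

/-! ### From exponential decay to convergence and boundedness. -/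

section Decay

variable {E : Type*} [NormedAddCommGroup E] {f : ℝ → E} {p : E} {C c : ℝ}

theorem tendsto_of_norm_sq_le_exp (hc : 0 < c)
    (h : ∀ t, 0 ≤ t → ‖f t - p‖ ^ 2 ≤ C * Real.exp (-c * t)) : Tendsto f atTop (𝓝 p) := by
  have h0 : Tendsto (fun t => C * Real.exp (-c * t)) atTop (𝓝 (C * 0)) :=
    (Real.tendsto_exp_atBot.comp
      (tendsto_id.const_mul_atTop_of_neg (neg_neg_of_pos hc))).const_mul C
  rw [mul_zero] at h0
  have h1 : Tendsto (fun t => ‖f t - p‖ ^ 2) atTop (𝓝 0) :=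
    squeeze_zero' (Eventually.of_forall fun t => sq_nonneg _)
      ((eventually_ge_atTop 0).mono h) h0
  have h2 := h1.sqrt
  simp only [Real.sqrt_sq (norm_nonneg _), Real.sqrt_zero] at h2
  exact tendsto_iff_norm_sub_tendsto_zero.2 h2

theorem isBounded_image_of_norm_sq_le_exp (hC : 0 ≤ C) (hc : 0 < c)
    (h : ∀ t, 0 ≤ t → ‖f t - p‖ ^ 2 ≤ C * Real.exp (-c * t)) :
    Bornology.IsBounded (f '' Ici 0) := by
  refine (Metric.isBounded_closedBall (x := p) (r := √C)).subset ?_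
  rintro _ ⟨t, ht, rfl⟩
  rw [Metric.mem_closedBall, dist_eq_norm]
  refine Real.le_sqrt_of_sq_le ((h t ht).trans (mul_le_of_le_one_right hC ?_))
  rw [Real.exp_le_one_iff]
  have : 0 ≤ c * t := mul_nonneg hc.le ht
  linarith

end Decay

/-! ### Signs of the coefficients and the steady states. -/

namespace DataCenter

variable {n : ℕ} {dc : DataCenter n}

/-- The matrix `W⁻¹ M A`, which maps temperature differences to workloads. -/
noncomputable def workloadGain (dc : DataCenter n) : Matrix (Fin n) (Fin n) ℝ := dc.W⁻¹ * dc.M * dc.A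

theorem kappa_eq (dc : DataCenter n) :
    dc.kappa = (1 : Fin n → ℝ) ⬝ᵥ (dc.workloadGain *ᵥ (1 : Fin n → ℝ)) := rfl

theorem isUnit_det_M (hdc : dc.IsPhysical) : IsUnit dc.M.det := by
  rw [M, det_diagonal]
  exact (Finset.prod_ne_zero_iff.2 fun i _ => (mul_pos hdc.cp_pos (hdc.m_pos i)).ne').isUnit

theorem isUnit_det_W (hdc : dc.IsPhysical) : IsUnit dc.W.det := by
  rw [W, det_diagonal]
  exact (Finset.prod_ne_zero_iff.2 fun i _ => (hdc.w_pos i).ne').isUnit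

theorem M_mul_A (hdc : dc.IsPhysical) :
    dc.M * dc.A = (dc.ρ * dc.cp) • ((dc.γᵀ - 1) * dc.F) := by
  rw [A, mul_smul_comm, Matrix.mul_assoc dc.M⁻¹, mul_nonsing_inv_cancel_left _ _ (isUnit_det_M hdc)]

theorem W_inv_eq (hdc : dc.IsPhysical) : dc.W⁻¹ = diagonal fun i => (dc.w i)⁻¹ := by
  refine inv_eq_left_inv ?_
  rw [W, diagonal_mul_diagonal, ← diagonal_one]
  congr 1
  ext i
  exact inv_mul_cancel₀ (hdc.w_pos i).ne'

theorem workloadGain_apply (hdc : dc.IsPhysical) (i j : Fin n) :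
    dc.workloadGain i j =
      (dc.w i)⁻¹ * (dc.ρ * dc.cp * ((dc.γ j i - (1 : Matrix (Fin n) (Fin n) ℝ) i j) * dc.f j)) := by
  rw [workloadGain, Matrix.mul_assoc, M_mul_A hdc, W_inv_eq hdc, diagonal_mul, Matrix.smul_apply, F,
    mul_diagonal, Matrix.sub_apply, transpose_apply, smul_eq_mul]

/-- Row `i` of `(Γᵀ - I) F` sums to minus the flow that rack `i` receives from the cooling unit. -/
theorem workloadGain_mulVec_one_neg (hdc : dc.IsPhysical) (i : Fin n) :
    (dc.workloadGain *ᵥ (1 : Fin n → ℝ)) i < 0 := by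
  have h : (dc.workloadGain *ᵥ (1 : Fin n → ℝ)) i =
      (dc.w i)⁻¹ * (dc.ρ * dc.cp) * -(dc.f i - ∑ j, dc.γ j i * dc.f j) := by
    simp only [mulVec, dotProduct, Pi.one_apply, mul_one, workloadGain_apply hdc, sub_mul,
      ← Finset.mul_sum, Finset.sum_sub_distrib, one_apply, ite_mul, one_mul, zero_mul,
      Finset.sum_ite_eq, Finset.mem_univ, if_true]
    ring
  rw [h]
  exact mul_neg_of_pos_of_neg
    (mul_pos (inv_pos.2 (hdc.w_pos i)) (mul_pos hdc.ρ_pos hdc.cp_pos))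
    (neg_neg_of_pos (hdc.supply_pos i))

theorem kappa_neg (hn : 0 < n) (hdc : dc.IsPhysical) : dc.kappa < 0 := by
  rw [kappa_eq, one_dotProduct]
  exact Finset.sum_neg (fun i _ => workloadGain_mulVec_one_neg hdc i)
    ⟨⟨0, hn⟩, Finset.mem_univ _⟩

/-- Homogeneity pulls `w⁻¹` out of the column sums, which leaves minus the returned exhaust flow of
rack `j`; dividing by `kappa < 0` makes it positive. -/
theorem C₁_pos (hn : 0 < n) (hdc : dc.IsPhysical) (hhom : dc.IsHomogeneous) (j : Fin n) :
    0 < dc.C₁ j := by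
  have h : ((1 : Fin n → ℝ) ᵥ* dc.workloadGain) j =
      (dc.w j)⁻¹ * (dc.ρ * dc.cp) * -((1 - ∑ i, dc.γ j i) * dc.f j) := by
    simp only [vecMul, dotProduct, Pi.one_apply, one_mul, workloadGain_apply hdc, hhom.2 _ j,
      ← Finset.mul_sum, ← Finset.sum_mul, Finset.sum_sub_distrib, one_apply,
      Finset.sum_ite_eq', Finset.mem_univ, if_true]
    ring
  have hneg : ((1 : Fin n → ℝ) ᵥ* dc.workloadGain) j < 0 := by
    rw [h]
    exact mul_neg_of_pos_of_neg
      (mul_pos (inv_pos.2 (hdc.w_pos j)) (mul_pos hdc.ρ_pos hdc.cp_pos))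
      (neg_neg_of_pos (hdc.return_pos j))
  exact mul_pos_of_neg_of_neg (inv_lt_zero.2 (kappa_neg hn hdc)) hneg

theorem B_mulVec_injective (hdc : dc.IsPhysical) : Function.Injective (dc.B *ᵥ ·) := by
  refine mulVec_injective_of_isUnit ?_
  rw [isUnit_iff_isUnit_det, B, det_mul]
  exact (isUnit_nonsing_inv_det _ (isUnit_det_M hdc)).mul (isUnit_det_W hdc)

theorem B_mul_workloadGain (hdc : dc.IsPhysical) : dc.B * dc.workloadGain = dc.A := by
  rw [B, workloadGain, Matrix.mul_assoc, Matrix.mul_assoc dc.W⁻¹,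
    mul_nonsing_inv_cancel_left _ _ (isUnit_det_W hdc),
    nonsing_inv_mul_cancel_left _ _ (isUnit_det_M hdc)]

/-- Factoring out the invertible `B` lets the steady-state equation be solved for `D`. -/
theorem thermalField_eq (hdc : dc.IsPhysical) (T : Fin n → ℝ) (τ : ℝ) (D : Fin n → ℝ) :
    dc.thermalField T τ D =
      dc.B *ᵥ (D + dc.workloadGain *ᵥ (T - τ • (1 : Fin n → ℝ)) + dc.W⁻¹ *ᵥ dc.v) := by
  have hv : dc.B *ᵥ (dc.W⁻¹ *ᵥ dc.v) = dc.M⁻¹ *ᵥ dc.v := by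
    rw [mulVec_mulVec, B, mul_nonsing_inv_cancel_right _ _ (isUnit_det_W hdc)]
  rw [mulVec_add, mulVec_add, hv, mulVec_mulVec, B_mul_workloadGain hdc, thermalField, P,
    mulVec_add, mulVec_mulVec, ← B]
  abel

theorem thermalField_eq_zero_iff (hdc : dc.IsPhysical) (T : Fin n → ℝ) (τ : ℝ) (D : Fin n → ℝ) :
    dc.thermalField T τ D = 0 ↔
      D = -(dc.workloadGain *ᵥ (T - τ • (1 : Fin n → ℝ))) - dc.W⁻¹ *ᵥ dc.v := by
  rw [thermalField_eq hdc, ← mulVec_zero dc.B, (B_mulVec_injective hdc).eq_iff, add_assoc,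
    add_eq_zero_iff_eq_neg, neg_add']

theorem steadyD_eq (dc : DataCenter n) (Dstar : ℝ) (T : Fin n → ℝ) :
    dc.steadyD Dstar T =
      -(dc.workloadGain *ᵥ (T - dc.steadyTsup Dstar T • (1 : Fin n → ℝ))) - dc.W⁻¹ *ᵥ dc.v := by
  have hG : dc.W⁻¹ * dc.M * dc.A = dc.workloadGain := rfl
  simp only [steadyD, C₃, C₄, steadyTsup, hG, neg_mulVec, ← mulVec_mulVec, sub_mulVec,
    one_mulVec, vecMulVec_mulVec, mulVec_sub, mulVec_smul, add_smul, mulVec_add, op_smul_eq_smul]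
  abel

/-- The slope `kappa` in `τ` is nonzero, so prescribing the total workload fixes the supply
temperature. -/
theorem one_dotProduct_steady (dc : DataCenter n) (hκ : dc.kappa ≠ 0) (T : Fin n → ℝ)
    (τ Dstar : ℝ) :
    (1 : Fin n → ℝ) ⬝ᵥ
      (-(dc.workloadGain *ᵥ (T - τ • (1 : Fin n → ℝ))) - dc.W⁻¹ *ᵥ dc.v) =
      Dstar + dc.kappa * (τ - dc.steadyTsup Dstar T) := by
  have h1 : dc.C₁ ⬝ᵥ T = dc.kappa⁻¹ * ((1 : Fin n → ℝ) ⬝ᵥ (dc.workloadGain *ᵥ T)) := by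
    rw [C₁, ← workloadGain, smul_dotProduct, dotProduct_mulVec, smul_eq_mul]
  rw [steadyTsup, h1, C₂, dotProduct_sub, dotProduct_neg, mulVec_sub, dotProduct_sub, mulVec_smul,
    dotProduct_smul, ← kappa_eq, smul_eq_mul]
  field_simp
  ring

theorem steady_iff (hn : 0 < n) (hdc : dc.IsPhysical) (T : Fin n → ℝ) (τ : ℝ) (D : Fin n → ℝ)
    (Dstar : ℝ) :
    dc.thermalField T τ D = 0 ∧ (1 : Fin n → ℝ) ⬝ᵥ D = Dstar ↔
      τ = dc.steadyTsup Dstar T ∧ D = dc.steadyD Dstar T := by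
  have hκ := (kappa_neg hn hdc).ne
  rw [thermalField_eq_zero_iff hdc]
  constructor
  · rintro ⟨rfl, h⟩
    rw [one_dotProduct_steady dc hκ T τ Dstar] at h
    have hτ : τ = dc.steadyTsup Dstar T := by
      have : dc.kappa * (τ - dc.steadyTsup Dstar T) = 0 := by linarith
      exact sub_eq_zero.1 ((mul_eq_zero.1 this).resolve_left hκ)
    exact ⟨hτ, by rw [steadyD_eq, ← hτ]⟩
  · rintro ⟨rfl, rfl⟩
    refine ⟨steadyD_eq .., ?_⟩
    rw [steadyD_eq, one_dotProduct_steady dc hκ T _ Dstar, sub_self, mul_zero, add_zero]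

/-- The deviation of the thermal model from its steady state. -/
theorem thermalField_eq_sub (hn : 0 < n) (hdc : dc.IsPhysical) (Dstar : ℝ) (T₀ T : Fin n → ℝ)
    (τ : ℝ) (D : Fin n → ℝ) :
    dc.thermalField T τ D = dc.A *ᵥ (T - T₀) +
      (dc.B *ᵥ (D - dc.steadyD Dstar T₀) -
        (τ - dc.steadyTsup Dstar T₀) • (dc.A *ᵥ (1 : Fin n → ℝ))) := by
  have h0 := ((steady_iff hn hdc T₀ _ _ Dstar).2 ⟨rfl, rfl⟩).1
  rw [← sub_zero (dc.thermalField T τ D), ← h0, thermalField_eq hdc, thermalField_eq hdc,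
    ← B_mul_workloadGain hdc]
  simp only [← mulVec_mulVec, ← mulVec_sub, ← mulVec_add, ← mulVec_smul]
  congr 1
  simp only [mulVec_sub, mulVec_smul, sub_smul]
  abel

end DataCenter

/-! ### The power minimization problem. -/

namespace DataCenter

variable {n : ℕ} {dc : DataCenter n} {R : Set ℝ} {COP : ℝ → ℝ} {Tsafe Dmax : Fin n → ℝ}
  {Dstar : ℝ} {T : Fin n → ℝ} {τ : ℝ} {D : Fin n → ℝ}

/-- Energy balance: multiply the steady-state equation by `M` and sum over the racks. -/
theorem heatRemoved_of_steady (hdc : dc.IsPhysical) (h : dc.thermalField T τ D = 0) :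
    dc.heatRemoved T τ = (1 : Fin n → ℝ) ⬝ᵥ dc.P D := by
  have h1 : dc.M *ᵥ dc.thermalField T τ D =
      (dc.M * dc.A) *ᵥ (T - τ • (1 : Fin n → ℝ)) + dc.P D := by
    rw [thermalField, mulVec_add, mulVec_mulVec, mulVec_mulVec, mul_nonsing_inv _ (isUnit_det_M hdc),
      one_mulVec]
  rw [h, mulVec_zero] at h1
  rw [heatRemoved, eq_neg_of_add_eq_zero_left h1.symm, dotProduct_neg, neg_neg]

theorem one_dotProduct_P (hhom : dc.IsHomogeneous) (i : Fin n) (D : Fin n → ℝ) :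
    (1 : Fin n → ℝ) ⬝ᵥ dc.P D = ∑ j, dc.v j + dc.w i * ((1 : Fin n → ℝ) ⬝ᵥ D) := by
  rw [P, dotProduct_add, one_dotProduct, one_dotProduct, one_dotProduct, Finset.mul_sum]
  congr 1
  refine Finset.sum_congr rfl fun j _ => ?_
  rw [W, mulVec_diagonal, hhom.2 j i]

/-- With homogeneous racks the total power of the racks is the same for all feasible points, so the
cost depends on the supply temperature only. -/
theorem IsFeasible.cost_eq (h : dc.IsFeasible R Tsafe Dmax Dstar T τ D) (hdc : dc.IsPhysical)
    (hhom : dc.IsHomogeneous) (i : Fin n) :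
    dc.cost COP T τ D =
      (∑ j, dc.v j + dc.w i * Dstar) / COP τ + (∑ j, dc.v j + dc.w i * Dstar) := by
  rw [cost, heatRemoved_of_steady hdc h.steady.symm, one_dotProduct_P hhom i, ← h.workload]

theorem IsFeasible.eq_steady (h : dc.IsFeasible R Tsafe Dmax Dstar T τ D) (hn : 0 < n)
    (hdc : dc.IsPhysical) : τ = dc.steadyTsup Dstar T ∧ D = dc.steadyD Dstar T :=
  (steady_iff hn hdc T τ D Dstar).1 ⟨h.steady.symm, h.workload.symm⟩

theorem isFeasible_steady (hn : 0 < n) (hdc : dc.IsPhysical)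
    (hD : ∀ i, 0 ≤ dc.steadyD Dstar T i ∧ dc.steadyD Dstar T i ≤ Dmax i)
    (hR : dc.steadyTsup Dstar T ∈ R) (hT : ∀ i, T i ≤ Tsafe i) :
    dc.IsFeasible R Tsafe Dmax Dstar T (dc.steadyTsup Dstar T) (dc.steadyD Dstar T) := by
  have h := (steady_iff hn hdc T _ _ Dstar).2 ⟨rfl, rfl⟩
  exact ⟨hR, h.2.symm, fun i => (hD i).1, fun i => (hD i).2, h.1.symm, hT⟩

theorem IsFeasible.workload_nonneg (h : dc.IsFeasible R Tsafe Dmax Dstar T τ D) : 0 ≤ Dstar := by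
  rw [h.workload, one_dotProduct]
  exact Finset.sum_nonneg fun i _ => h.nonneg i

theorem steadyTsup_mono (hn : 0 < n) (hdc : dc.IsPhysical) (hhom : dc.IsHomogeneous) :
    Monotone (dc.steadyTsup Dstar) := fun _ _ hT =>
  add_le_add_left (Finset.sum_le_sum fun i _ =>
    mul_le_mul_of_nonneg_left (hT i) (C₁_pos hn hdc hhom i).le) _

theorem steadyTsup_strictMono (hn : 0 < n) (hdc : dc.IsPhysical) (hhom : dc.IsHomogeneous) :
    StrictMono (dc.steadyTsup Dstar) := fun T T' hT => by
  obtain ⟨hle, i, hi⟩ := Pi.lt_def.1 hT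
  refine add_lt_add_left (Finset.sum_lt_sum (fun i _ =>
    mul_le_mul_of_nonneg_left (hle i) (C₁_pos hn hdc hhom i).le) ⟨i, Finset.mem_univ _, ?_⟩) _
  exact mul_lt_mul_of_pos_left hi (C₁_pos hn hdc hhom i)

theorem continuous_steadyTsup (dc : DataCenter n) (Dstar : ℝ) :
    Continuous (dc.steadyTsup Dstar) :=
  (continuous_const.dotProduct continuous_id).add continuous_const

theorem continuous_steadyD (dc : DataCenter n) (Dstar : ℝ) : Continuous (dc.steadyD Dstar) :=
  (continuous_const.matrix_mulVec continuous_id).add continuous_const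

theorem rackPower_nonneg (hdc : dc.IsPhysical) (i : Fin n) (hD : 0 ≤ Dstar) :
    0 ≤ ∑ j, dc.v j + dc.w i * Dstar :=
  add_nonneg (Finset.sum_nonneg fun j _ => hdc.v_nonneg j) (mul_nonneg (hdc.w_pos i).le hD)

theorem rackPower_pos (hdc : dc.IsPhysical) (i : Fin n) (hD : 0 < Dstar) :
    0 < ∑ j, dc.v j + dc.w i * Dstar :=
  add_pos_of_nonneg_of_pos (Finset.sum_nonneg fun j _ => hdc.v_nonneg j)
    (mul_pos (hdc.w_pos i) hD)

/-- Any competitor has `T' ≤ Tsafe`, hence a supply temperature no higher and a `COP` no larger,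
while the rack power in the numerator is the same. -/
theorem isOptimal_steady (hn : 0 < n) (hdc : dc.IsPhysical) (hhom : dc.IsHomogeneous)
    (hCOP_pos : ∀ τ ∈ R, 0 < COP τ) (hCOP_mono : MonotoneOn COP R)
    (hD : ∀ i, 0 ≤ dc.steadyD Dstar Tsafe i ∧ dc.steadyD Dstar Tsafe i ≤ Dmax i)
    (hR : dc.steadyTsup Dstar Tsafe ∈ R) :
    dc.IsOptimal COP R Tsafe Dmax Dstar
      Tsafe (dc.steadyTsup Dstar Tsafe) (dc.steadyD Dstar Tsafe) := by
  have hfeas := isFeasible_steady (Tsafe := Tsafe) hn hdc hD hR fun i => le_rfl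
  refine ⟨hfeas, fun T' τ' D' h => ?_⟩
  rw [hfeas.cost_eq hdc hhom ⟨0, hn⟩, h.cost_eq hdc hhom ⟨0, hn⟩]
  have hτ : τ' ≤ dc.steadyTsup Dstar Tsafe := by
    rw [(h.eq_steady hn hdc).1]
    exact steadyTsup_mono hn hdc hhom h.safe
  exact add_le_add_left (div_le_div_of_nonneg_left (rackPower_nonneg hdc _ h.workload_nonneg)
    (hCOP_pos _ h.range) (hCOP_mono h.range hR hτ)) _

/-- A feasible point is better than another one if its supply temperature is higher. -/
theorem cost_lt_cost (hdc : dc.IsPhysical) (hhom : dc.IsHomogeneous) (i : Fin n)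
    (hCOP_pos : ∀ τ ∈ R, 0 < COP τ) (hCOP : StrictMonoOn COP R) (hDstar : 0 < Dstar)
    {T' : Fin n → ℝ} {τ' : ℝ} {D' : Fin n → ℝ}
    (h : dc.IsFeasible R Tsafe Dmax Dstar T τ D) (h' : dc.IsFeasible R Tsafe Dmax Dstar T' τ' D')
    (hτ : τ < τ') : dc.cost COP T' τ' D' < dc.cost COP T τ D := by
  rw [h.cost_eq hdc hhom i, h'.cost_eq hdc hhom i]
  exact add_lt_add_left (div_lt_div_of_pos_left (rackPower_pos hdc _ hDstar)
    (hCOP_pos _ h.range) (hCOP h.range h'.range hτ)) _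

theorem IsOptimal.eq_steady (hn : 0 < n) (hdc : dc.IsPhysical) (hhom : dc.IsHomogeneous)
    (hCOP_pos : ∀ τ ∈ R, 0 < COP τ) (hCOP : StrictMonoOn COP R) (hDstar : 0 < Dstar)
    (hD : ∀ i, 0 ≤ dc.steadyD Dstar Tsafe i ∧ dc.steadyD Dstar Tsafe i ≤ Dmax i)
    (hR : dc.steadyTsup Dstar Tsafe ∈ R)
    (h : dc.IsOptimal COP R Tsafe Dmax Dstar T τ D) :
    T = Tsafe ∧ τ = dc.steadyTsup Dstar Tsafe ∧ D = dc.steadyD Dstar Tsafe := by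
  obtain ⟨hτ, hD'⟩ := h.1.eq_steady hn hdc
  have hT : T = Tsafe := by
    by_contra hne
    have hlt := steadyTsup_strictMono (Dstar := Dstar) hn hdc hhom
      (lt_of_le_of_ne (show T ≤ Tsafe from h.1.safe) hne)
    have hfeas := isFeasible_steady (Tsafe := Tsafe) hn hdc hD hR fun i => le_rfl
    rw [← hτ] at hlt
    exact (h.2 _ _ _ hfeas).not_gt
      (cost_lt_cost hdc hhom ⟨0, hn⟩ hCOP_pos hCOP hDstar h.1 hfeas hlt)
  subst hT
  exact ⟨rfl, hτ, hD'⟩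

/-- If the safety constraint of some rack were not active, then moving `T` towards `Tsafe` would
increase the supply temperature and keep the other, inactive, constraints satisfied. -/
theorem IsOptimal.eq_steady_of_inactive (hn : 0 < n) (hdc : dc.IsPhysical)
    (hhom : dc.IsHomogeneous) (hCOP_pos : ∀ τ ∈ R, 0 < COP τ) (hCOP : StrictMonoOn COP R)
    (h : dc.IsOptimal COP R Tsafe Dmax Dstar T τ D) (hD : ∀ i, 0 < D i ∧ D i < Dmax i)
    (hR : τ ∈ interior R) :
    T = Tsafe ∧ τ = dc.steadyTsup Dstar Tsafe ∧ D = dc.steadyD Dstar Tsafe := by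
  have hDstar : 0 < Dstar := by
    rw [h.1.workload, one_dotProduct]
    exact Finset.sum_pos (fun i _ => (hD i).1) ⟨⟨0, hn⟩, Finset.mem_univ _⟩
  obtain ⟨hτ, hD'⟩ := h.1.eq_steady hn hdc
  have hT : T = Tsafe := by
    by_contra hne
    have hlt : T < Tsafe := lt_of_le_of_ne h.1.safe hne
    have hcont : Tendsto (fun ε : ℝ => T + ε • (Tsafe - T)) (𝓝[>] 0) (𝓝 T) := by
      have : Continuous fun ε : ℝ => T + ε • (Tsafe - T) := by fun_prop
      have h0 := this.tendsto 0
      simp only [zero_smul, add_zero] at h0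
      exact h0.mono_left nhdsWithin_le_nhds
    have hτε : ∀ᶠ ε in 𝓝[>] (0 : ℝ), dc.steadyTsup Dstar (T + ε • (Tsafe - T)) ∈ R := by
      have h1 := ((continuous_steadyTsup dc Dstar).tendsto T).comp hcont
      rw [← hτ] at h1
      exact h1.eventually (mem_interior_iff_mem_nhds.1 hR)
    have hDε : ∀ᶠ ε in 𝓝[>] (0 : ℝ), ∀ i, 0 ≤ dc.steadyD Dstar (T + ε • (Tsafe - T)) i ∧
        dc.steadyD Dstar (T + ε • (Tsafe - T)) i ≤ Dmax i := by
      refine eventually_all.2 fun i => ?_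
      have h1 := ((continuous_steadyD dc Dstar).tendsto T).comp hcont
      rw [← hD'] at h1
      have h2 := tendsto_pi_nhds.1 h1 i
      filter_upwards [h2.eventually (eventually_gt_nhds (hD i).1),
        h2.eventually (eventually_lt_nhds (hD i).2)] with ε h3 h4
      exact ⟨h3.le, h4.le⟩
    -- `ε < 1` keeps `T + ε (Tsafe - T)` below `Tsafe`; `ε > 0` makes the supply temperature
    -- strictly larger.
    obtain ⟨ε, hτε, hDε, hε0, hε1⟩ := (hτε.and (hDε.and (Ioo_mem_nhdsGT zero_lt_one))).exists
    have hsub : 0 < Tsafe - T := sub_pos.2 hlt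
    have hfeas := isFeasible_steady (Tsafe := Tsafe) hn hdc hDε hτε fun i => by
      have h1 := h.1.safe i
      have h2 : ε * (Tsafe i - T i) ≤ 1 * (Tsafe i - T i) :=
        mul_le_mul_of_nonneg_right hε1.le (by linarith)
      simp only [Pi.add_apply, Pi.smul_apply, Pi.sub_apply, smul_eq_mul]
      linarith
    have hlt' := steadyTsup_strictMono (Dstar := Dstar) hn hdc hhom
      (lt_add_of_pos_right T (smul_pos hε0 hsub))
    rw [← hτ] at hlt'
    exact (h.2 _ _ _ hfeas).not_gt
      (cost_lt_cost hdc hhom ⟨0, hn⟩ hCOP_pos hCOP hDstar h.1 hfeas hlt')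
  subst hT
  exact ⟨rfl, hτ, hD'⟩

end DataCenter

/-! ### The closed loop: existence of solutions and the Lyapunov argument. -/

namespace DataCenter

variable {n : ℕ} {dc : DataCenter n} {Z : Matrix (Fin n) (Fin n) ℝ} {Tsafe : Fin n → ℝ}
  {Dstar : ℝ}

/-- `𝟙𝟙ᵀ/n - I`, the negative of the orthogonal projection onto the vectors with zero total. -/
noncomputable def balance (n : ℕ) : Matrix (Fin n) (Fin n) ℝ :=
  (n : ℝ)⁻¹ • vecMulVec (1 : Fin n → ℝ) (1 : Fin n → ℝ) - 1

theorem balance_mulVec (u : Fin n → ℝ) :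
    balance n *ᵥ u = ((n : ℝ)⁻¹ * ((1 : Fin n → ℝ) ⬝ᵥ u)) • (1 : Fin n → ℝ) - u := by
  rw [balance, sub_mulVec, one_mulVec, smul_mulVec, vecMulVec_mulVec, op_smul_eq_smul, smul_smul]

theorem one_dotProduct_balance (hn : 0 < n) (u : Fin n → ℝ) :
    (1 : Fin n → ℝ) ⬝ᵥ (balance n *ᵥ u) = 0 := by
  have : (n : ℝ) ≠ 0 := by positivity
  rw [balance_mulVec, dotProduct_sub, dotProduct_smul, one_dotProduct_one, Fintype.card_fin,
    smul_eq_mul]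
  field_simp
  ring

/-- Tested against zero-total vectors the projection is invisible, so the workload controller acts
in the energy like `-Bᵀ Z x`. -/
theorem dotProduct_balance {d : Fin n → ℝ} (hd : (1 : Fin n → ℝ) ⬝ᵥ d = 0) (u : Fin n → ℝ) :
    d ⬝ᵥ (balance n *ᵥ u) = -(d ⬝ᵥ u) := by
  rw [balance_mulVec, dotProduct_sub, dotProduct_smul, dotProduct_comm d 1, hd, smul_zero, zero_sub]

/-- The closed loop as a linear vector field in the deviations from the setpoint. -/
noncomputable def closedLoopMap (dc : DataCenter n) (Z : Matrix (Fin n) (Fin n) ℝ) :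
    ((Fin n → ℝ) × ℝ × (Fin n → ℝ)) →ₗ[ℝ] ((Fin n → ℝ) × ℝ × (Fin n → ℝ)) where
  toFun p := (dc.A *ᵥ p.1 + (dc.B *ᵥ p.2.2 - p.2.1 • (dc.A *ᵥ (1 : Fin n → ℝ))),
    (1 : Fin n → ℝ) ⬝ᵥ ((dc.Aᵀ * Z) *ᵥ p.1), balance n *ᵥ ((dc.Bᵀ * Z) *ᵥ p.1))
  map_add' p q := by
    simp only [Prod.fst_add, Prod.snd_add, mulVec_add, dotProduct_add, add_smul, Prod.mk_add_mk]
    congr 1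
    abel
  map_smul' c p := by
    simp only [Prod.smul_fst, Prod.smul_snd, mulVec_smul, dotProduct_smul, smul_assoc,
      Prod.smul_mk, smul_add, smul_sub, RingHom.id_apply]

theorem exists_isClosedLoopSolution (hn : 0 < n) (hdc : dc.IsPhysical)
    (Z : Matrix (Fin n) (Fin n) ℝ) (Tsafe T₀ : Fin n → ℝ) (τ₀ : ℝ) (D₀ : Fin n → ℝ) :
    ∃ Tout Tsup D, dc.IsClosedLoopSolution Z Tsafe Tout Tsup D ∧
      Tout 0 = T₀ ∧ Tsup 0 = τ₀ ∧ D 0 = D₀ := by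
  let L := (dc.closedLoopMap Z).toContinuousLinearMap
  -- Any equilibrium can serve as origin for the linear flow, whatever the total of `D₀`; total
  -- workload `0` is taken.
  let p₁ : (Fin n → ℝ) × ℝ × (Fin n → ℝ) := (Tsafe, dc.steadyTsup 0 Tsafe, dc.steadyD 0 Tsafe)
  let q : ℝ → (Fin n → ℝ) × ℝ × (Fin n → ℝ) := fun t =>
    NormedSpace.exp (t • L) ((T₀, τ₀, D₀) - p₁)
  have hq : ∀ t, HasDerivAt (fun t => q t + p₁) (dc.closedLoopMap Z (q t)) t := fun t =>
    ((hasDerivAt_exp_smul_const' L t).clm_apply (hasDerivAt_const t _)).add_const p₁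
      |>.congr_deriv (by rw [map_zero, add_zero]; rfl)
  have hq0 : q 0 + p₁ = (T₀, τ₀, D₀) := by
    simp [q, NormedSpace.exp_zero]
  have hfst : ∀ t, (q t + p₁).1 - Tsafe = (q t).1 := fun t => add_sub_cancel_right _ _
  have hfst' : ∀ t, HasDerivAt (fun t => (q t + p₁).1) (dc.closedLoopMap Z (q t)).1 t := fun t =>
    (ContinuousLinearMap.fst ℝ (Fin n → ℝ) (ℝ × (Fin n → ℝ))).hasFDerivAt.comp_hasDerivAt t (hq t)
  have hsnd' : ∀ t, HasDerivAt (fun t => (q t + p₁).2) (dc.closedLoopMap Z (q t)).2 t := fun t =>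
    (ContinuousLinearMap.snd ℝ (Fin n → ℝ) (ℝ × (Fin n → ℝ))).hasFDerivAt.comp_hasDerivAt t (hq t)
  refine ⟨fun t => (q t + p₁).1, fun t => (q t + p₁).2.1, fun t => (q t + p₁).2.2,
    ⟨fun t _ => ?_, fun t _ => ?_, fun t _ => ?_⟩, ?_, ?_, ?_⟩
  · rw [thermalField_eq_sub hn hdc 0 Tsafe, hfst]
    refine ((hfst' t).congr_deriv ?_).hasDerivWithinAt
    simp [closedLoopMap, p₁]
  · rw [hfst]
    exact (ContinuousLinearMap.fst ℝ ℝ (Fin n → ℝ) |>.hasFDerivAt.comp_hasDerivAt t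
      (hsnd' t)).hasDerivWithinAt
  · rw [hfst]
    exact (ContinuousLinearMap.snd ℝ ℝ (Fin n → ℝ) |>.hasFDerivAt.comp_hasDerivAt t
      (hsnd' t)).hasDerivWithinAt
  · simp only [hq0]
  · simp only [hq0]
  · simp only [hq0]

namespace IsClosedLoopSolution

variable {Tout : ℝ → Fin n → ℝ} {Tsup : ℝ → ℝ} {D : ℝ → Fin n → ℝ}

/-- The controllers keep the total workload constant. -/
theorem one_dotProduct_workload (h : dc.IsClosedLoopSolution Z Tsafe Tout Tsup D) (hn : 0 < n)
    {t : ℝ} (ht : 0 ≤ t) : (1 : Fin n → ℝ) ⬝ᵥ D t = (1 : Fin n → ℝ) ⬝ᵥ D 0 := by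
  have hd : ∀ t, 0 ≤ t → HasDerivWithinAt (fun t => (1 : Fin n → ℝ) ⬝ᵥ D t) 0 (Ici 0) t :=
    fun t ht => by
      refine ((hasDerivWithinAt_const t (Ici 0) (1 : Fin n → ℝ)).dotProduct
        (h.workload t ht)).congr_deriv ?_
      rw [zero_dotProduct, zero_add]
      exact one_dotProduct_balance hn _
  exact constant_of_has_deriv_right_zero
    (fun s hs => (hd s hs.1).continuousWithinAt.mono Icc_subset_Ici_self)
    (fun s hs => (hd s hs.1).mono (Ici_subset_Ici.2 hs.1)) t (right_mem_Icc.2 ht)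

end IsClosedLoopSolution

/-- The input `B d - s A 𝟙` determines the deviations `s` and `d` if `d` has zero total. -/
theorem exists_deviation_le (hn : 0 < n) (hdc : dc.IsPhysical) :
    ∃ C, 0 ≤ C ∧ ∀ (s : ℝ) (d : Fin n → ℝ), (1 : Fin n → ℝ) ⬝ᵥ d = 0 →
      s ^ 2 + d ⬝ᵥ d ≤ C * ((dc.B *ᵥ d - s • (dc.A *ᵥ (1 : Fin n → ℝ))) ⬝ᵥ
        (dc.B *ᵥ d - s • (dc.A *ᵥ (1 : Fin n → ℝ)))) := by
  have hκ := (kappa_neg hn hdc).ne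
  obtain ⟨C, hC, hCr⟩ := exists_mulVec_dotProduct_mulVec_le dc.B⁻¹
  set g := dc.workloadGain *ᵥ (1 : Fin n → ℝ) with hg
  have hgg := dotProduct_self_nonneg' g
  set k := (dc.kappa ^ 2)⁻¹ * n with hk
  have hk0 : 0 ≤ k := by positivity
  -- With `q = B⁻¹ r = d - s g`, the total of `q` is `-s kappa`, so Cauchy–Schwarz gives `s² ≤ (n /
  -- kappa²) |q|²`; then `d = q + s g` is bounded as well.
  refine ⟨(2 + (1 + 2 * (g ⬝ᵥ g)) * k) * C, by positivity, fun s d hd => ?_⟩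
  set r := dc.B *ᵥ d - s • (dc.A *ᵥ (1 : Fin n → ℝ)) with hr
  set q := d - s • g with hq
  have hBu : IsUnit dc.B.det := by
    rw [B, det_mul]
    exact (isUnit_nonsing_inv_det _ (isUnit_det_M hdc)).mul (isUnit_det_W hdc)
  have hqr : dc.B⁻¹ *ᵥ r = q := by
    have : r = dc.B *ᵥ q := by
      rw [hr, hq, mulVec_sub, mulVec_smul, hg, mulVec_mulVec, B_mul_workloadGain hdc]
    rw [this, mulVec_mulVec, nonsing_inv_mul _ hBu, one_mulVec]
  have hqq : q ⬝ᵥ q ≤ C * (r ⬝ᵥ r) := hqr ▸ hCr r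
  have hs : s ^ 2 ≤ k * (q ⬝ᵥ q) := by
    have h1 : (1 : Fin n → ℝ) ⬝ᵥ q = -(s * dc.kappa) := by
      rw [hq, dotProduct_sub, hd, dotProduct_smul, ← kappa_eq, smul_eq_mul, zero_sub]
    have h2 := dotProduct_sq_le (1 : Fin n → ℝ) q
    rw [h1, one_dotProduct_one, Fintype.card_fin, neg_sq, mul_pow] at h2
    rw [hk, mul_assoc, ← div_eq_inv_mul, le_div_iff₀ (by positivity)]
    exact h2
  have hdd : d ⬝ᵥ d ≤ 2 * (q ⬝ᵥ q) + 2 * (g ⬝ᵥ g) * s ^ 2 := by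
    have h1 : d = q + s • g := by rw [hq, sub_add_cancel]
    have h2 := two_mul_abs_dotProduct_le q (s • g)
    have h3 := le_abs_self (q ⬝ᵥ (s • g))
    have h4 : (s • g) ⬝ᵥ (s • g) = (g ⬝ᵥ g) * s ^ 2 := by
      rw [smul_dotProduct, dotProduct_smul, smul_eq_mul, smul_eq_mul]; ring
    rw [h1, add_dotProduct, dotProduct_add, dotProduct_add, dotProduct_comm (s • g) q]
    linarith
  have h1 := mul_le_mul_of_nonneg_left hs (show 0 ≤ 1 + 2 * (g ⬝ᵥ g) by positivity)
  have h2 := mul_le_mul_of_nonneg_left hqq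
    (show 0 ≤ 2 + (1 + 2 * (g ⬝ᵥ g)) * k by positivity)
  linarith

/-- Converse of `exists_deviation_le`, needed to bound `|r|²`, and so the cross term `⟨x, r⟩`, by
the energy. -/
theorem exists_input_le (dc : DataCenter n) :
    ∃ C, 0 ≤ C ∧ ∀ (s : ℝ) (d : Fin n → ℝ),
      (dc.B *ᵥ d - s • (dc.A *ᵥ (1 : Fin n → ℝ))) ⬝ᵥ (dc.B *ᵥ d - s • (dc.A *ᵥ (1 : Fin n → ℝ))) ≤
        C * (s ^ 2 + d ⬝ᵥ d) := by
  obtain ⟨C, hC, hCB⟩ := exists_mulVec_dotProduct_mulVec_le dc.B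
  set a := dc.A *ᵥ (1 : Fin n → ℝ) with ha
  have haa := dotProduct_self_nonneg' a
  refine ⟨2 * C + 2 * (a ⬝ᵥ a), by positivity, fun s d => ?_⟩
  have h1 := two_mul_abs_dotProduct_le (dc.B *ᵥ d) (s • a)
  have h2 := neg_abs_le ((dc.B *ᵥ d) ⬝ᵥ (s • a))
  have h3 : (s • a) ⬝ᵥ (s • a) = (a ⬝ᵥ a) * s ^ 2 := by
    rw [smul_dotProduct, dotProduct_smul, smul_eq_mul, smul_eq_mul]; ring
  have h4 := hCB d
  have h5 : 0 ≤ C * s ^ 2 := by positivity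
  have h6 := mul_nonneg haa (dotProduct_self_nonneg' d)
  rw [sub_dotProduct, dotProduct_sub, dotProduct_sub, dotProduct_comm (s • a) (dc.B *ᵥ d)]
  linarith

/-- The deviations from the setpoint decay exponentially. -/
theorem IsClosedLoopSolution.exists_energy_le (hn : 0 < n) (hdc : dc.IsPhysical) (hZ : Z.PosDef)
    (hLyap : dc.Aᵀ * Z + Z * dc.A = -(2 : ℝ) • (1 : Matrix (Fin n) (Fin n) ℝ))
    {Tout : ℝ → Fin n → ℝ} {Tsup : ℝ → ℝ} {D : ℝ → Fin n → ℝ}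
    (h : dc.IsClosedLoopSolution Z Tsafe Tout Tsup D)
    (hD : (1 : Fin n → ℝ) ⬝ᵥ D 0 = Dstar) :
    ∃ C c, 0 ≤ C ∧ 0 < c ∧ ∀ t, 0 ≤ t →
      ‖Tout t - Tsafe‖ ^ 2 ≤ C * Real.exp (-c * t) ∧
      ‖Tsup t - dc.steadyTsup Dstar Tsafe‖ ^ 2 ≤ C * Real.exp (-c * t) ∧
      ‖D t - dc.steadyD Dstar Tsafe‖ ^ 2 ≤ C * Real.exp (-c * t) := by
  obtain ⟨Cz, hCz, hz⟩ := hZ.exists_dotProduct_self_le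
  obtain ⟨Cu, hCu, hu⟩ := exists_mulVec_dotProduct_mulVec_le Z
  obtain ⟨Cd, hCd, hdev⟩ := exists_deviation_le hn hdc
  obtain ⟨Ci, hCi, hinp⟩ := exists_input_le dc
  set x : ℝ → Fin n → ℝ := fun t => Tout t - Tsafe with hx
  set s : ℝ → ℝ := fun t => Tsup t - dc.steadyTsup Dstar Tsafe with hs
  set d : ℝ → Fin n → ℝ := fun t => D t - dc.steadyD Dstar Tsafe with hd
  set r : ℝ → Fin n → ℝ := fun t => dc.B *ᵥ d t - s t • (dc.A *ᵥ (1 : Fin n → ℝ)) with hr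
  have hZT : Zᵀ = Z := by simpa [IsHermitian] using hZ.isHermitian
  have hq : ∀ x, 0 ≤ x ⬝ᵥ (Z *ᵥ x) := fun x => by
    simpa using hZ.posSemidef.dotProduct_mulVec_nonneg x
  have hd1 : ∀ t, 0 ≤ t → (1 : Fin n → ℝ) ⬝ᵥ d t = 0 := fun t ht => by
    rw [hd, dotProduct_sub, h.one_dotProduct_workload hn ht, hD,
      ((steady_iff hn hdc Tsafe _ _ Dstar).2 ⟨rfl, rfl⟩).2, sub_self]
  have hx' : ∀ t, 0 ≤ t → HasDerivWithinAt x (dc.A *ᵥ x t + r t) (Ici 0) t := fun t ht =>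
    ((h.thermal t ht).sub_const Tsafe).congr_deriv (thermalField_eq_sub hn hdc Dstar Tsafe _ _ _)
  have hs' : ∀ t, 0 ≤ t → HasDerivWithinAt s
      ((1 : Fin n → ℝ) ⬝ᵥ ((dc.Aᵀ * Z) *ᵥ x t)) (Ici 0) t := fun t ht =>
    (h.supply t ht).sub_const _
  have hd' : ∀ t, 0 ≤ t → HasDerivWithinAt d
      (balance n *ᵥ ((dc.Bᵀ * Z) *ᵥ x t)) (Ici 0) t := fun t ht =>
    (h.workload t ht).sub_const _
  -- Both controllers are driven by `x` alone, so `r'` is a fixed matrix applied to `x`.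
  have hr' : ∀ t, 0 ≤ t → HasDerivWithinAt r ((dc.B * balance n * (dc.Bᵀ * Z) -
      vecMulVec (dc.A *ᵥ (1 : Fin n → ℝ)) ((1 : Fin n → ℝ) ᵥ* (dc.Aᵀ * Z))) *ᵥ x t) (Ici 0) t :=
    fun t ht => by
      refine (((hd' t ht).matrix_mulVec dc.B).sub ((hs' t ht).smul_const _)).congr_deriv ?_
      rw [sub_mulVec, vecMulVec_mulVec, op_smul_eq_smul, ← dotProduct_mulVec, mulVec_mulVec,
        mulVec_mulVec, ← Matrix.mul_assoc]
  have hV' : ∀ t, 0 ≤ t → HasDerivWithinAt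
      (fun t => x t ⬝ᵥ (Z *ᵥ x t) + (s t * s t + d t ⬝ᵥ d t)) (-2 * (x t ⬝ᵥ x t)) (Ici 0) t :=
    fun t ht => by
      refine (((hx' t ht).dotProduct ((hx' t ht).matrix_mulVec Z)).add
        (((hs' t ht).mul (hs' t ht)).add ((hd' t ht).dotProduct (hd' t ht)))).congr_deriv ?_
      have h1 : (dc.A *ᵥ x t) ⬝ᵥ (Z *ᵥ x t) + x t ⬝ᵥ (Z *ᵥ (dc.A *ᵥ x t)) =
          -2 * (x t ⬝ᵥ x t) := by
        have := congrArg (fun Q => x t ⬝ᵥ (Q *ᵥ x t)) hLyap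
        simp only [add_mulVec, dotProduct_add, smul_mulVec, one_mulVec, dotProduct_smul,
          smul_eq_mul, ← mulVec_mulVec] at this
        rw [← this, dotProduct_mulVec (x t) dc.Aᵀ, vecMul_transpose]
      have h2 : x t ⬝ᵥ (Z *ᵥ r t) = r t ⬝ᵥ (Z *ᵥ x t) := by
        rw [dotProduct_mulVec, ← mulVec_transpose, hZT, dotProduct_comm]
      have h3 : r t ⬝ᵥ (Z *ᵥ x t) = d t ⬝ᵥ ((dc.Bᵀ * Z) *ᵥ x t) -
          s t * ((1 : Fin n → ℝ) ⬝ᵥ ((dc.Aᵀ * Z) *ᵥ x t)) := by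
        rw [← mulVec_mulVec, ← mulVec_mulVec, dotProduct_mulVec (d t), vecMul_transpose,
          dotProduct_mulVec 1, vecMul_transpose, hr, sub_dotProduct, smul_dotProduct, smul_eq_mul]
      -- The power `2 ⟨r, Z x⟩` that `r` feeds into `xᵀ Z x` cancels exactly against the derivative
      -- of `s² + |d|²`; the Lyapunov equation leaves `-2 |x|²`.
      rw [dotProduct_comm (balance n *ᵥ _) (d t), dotProduct_balance (hd1 t ht), mulVec_add,
        add_dotProduct, dotProduct_add, h2, h3, ← h1]
      ring
  have hss : ∀ t, 0 ≤ s t * s t := fun t => mul_self_nonneg _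
  have hdd : ∀ t, 0 ≤ d t ⬝ᵥ d t := fun t => dotProduct_self_nonneg' _
  obtain ⟨C, c, hC, hc, hdecay⟩ := exists_energy_le_exp (a := Cz + Ci) (b := 1 + Cu + Cd) dc.A _
    (by positivity) (by positivity) hx' hr' hV'
    (fun t _ => add_nonneg (hq _) (add_nonneg (hss t) (hdd t)))
    (fun t _ => by
      have h1 := hz (x t)
      have h2 := hinp (s t) (d t)
      rw [sq] at h2
      have h3 := mul_nonneg hCz (add_nonneg (hss t) (hdd t))
      have h4 := mul_nonneg hCi (hq (x t))
      linarith)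
    (fun t ht => by
      have h1 := hdev (s t) (d t) (hd1 t ht)
      rw [sq] at h1
      have h2 := two_mul_abs_dotProduct_le (x t) (Z *ᵥ x t)
      have h3 := le_abs_self (x t ⬝ᵥ (Z *ᵥ x t))
      have h4 := hu (x t)
      have h5 := dotProduct_self_nonneg' (x t)
      have h6 := dotProduct_self_nonneg' (r t)
      have h7 := mul_nonneg hCd h5
      have h8 := mul_nonneg hCu h6
      have h9 := mul_nonneg hCu h5
      linarith)
  refine ⟨(Cz + 1) * C, c, by positivity, hc, fun t ht => ?_⟩
  have hdec := hdecay t ht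
  have h0 := mul_nonneg hC (Real.exp_pos (-c * t)).le
  have h1 := hz (x t)
  have h2 := mul_le_mul_of_nonneg_left hdec hCz
  have h3 := mul_nonneg hCz (add_nonneg (hss t) (hdd t))
  have h4 := mul_nonneg hCz h0
  have h5 := hq (x t)
  refine ⟨(norm_sq_le_dotProduct_self (x t)).trans ?_, ?_,
    (norm_sq_le_dotProduct_self (d t)).trans ?_⟩
  · linarith
  · rw [Real.norm_eq_abs, sq_abs, sq]
    have := hss t
    have := hdd t
    change s t * s t ≤ _
    linarith
  · have := hss t
    linarith

end DataCenter

/-! ### The theorem. -/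

theorem mainTheorem4 {n : ℕ} (hn : 0 < n) (dc : DataCenter n) (hdc : dc.IsPhysical)
    (Z : Matrix (Fin n) (Fin n) ℝ) (hZ : Z.PosDef)
    (hLyap : dc.Aᵀ * Z + Z * dc.A = -(2 : ℝ) • (1 : Matrix (Fin n) (Fin n) ℝ))
    (Tsafe Dmax : Fin n → ℝ) (Dstar : ℝ)
    (COP : ℝ → ℝ) (R : Set ℝ) (hCOP_pos : ∀ τ ∈ R, 0 < COP τ) (hCOP_mono : MonotoneOn COP R) :
    -- closed-loop solutions exist for all initial values with total workload `Dstar`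
    (∀ (T₀ : Fin n → ℝ) (τ₀ : ℝ) (D₀ : Fin n → ℝ), (1 : Fin n → ℝ) ⬝ᵥ D₀ = Dstar →
      ∃ Tout Tsup D, dc.IsClosedLoopSolution Z Tsafe Tout Tsup D ∧
        Tout 0 = T₀ ∧ Tsup 0 = τ₀ ∧ D 0 = D₀) ∧
    -- they are all bounded and converge to the setpoints
    (∀ (Tout : ℝ → Fin n → ℝ) (Tsup : ℝ → ℝ) (D : ℝ → Fin n → ℝ),
      dc.IsClosedLoopSolution Z Tsafe Tout Tsup D → (1 : Fin n → ℝ) ⬝ᵥ D 0 = Dstar →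
      Bornology.IsBounded ((fun t => (Tout t, Tsup t, D t)) '' Ici 0) ∧
      Tendsto Tout atTop (𝓝 Tsafe) ∧
      Tendsto Tsup atTop (𝓝 (dc.steadyTsup Dstar Tsafe)) ∧
      Tendsto D atTop (𝓝 (dc.steadyD Dstar Tsafe))) ∧
    -- the setpoints are the optimal ones
    (dc.IsHomogeneous →
      ((∀ i, 0 ≤ dc.steadyD Dstar Tsafe i ∧ dc.steadyD Dstar Tsafe i ≤ Dmax i) →
        dc.steadyTsup Dstar Tsafe ∈ R →
        dc.IsOptimal COP R Tsafe Dmax Dstar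
          Tsafe (dc.steadyTsup Dstar Tsafe) (dc.steadyD Dstar Tsafe) ∧
        (StrictMonoOn COP R → 0 < Dstar → ∀ (T : Fin n → ℝ) (τ : ℝ) (D : Fin n → ℝ),
          dc.IsOptimal COP R Tsafe Dmax Dstar T τ D →
          T = Tsafe ∧ τ = dc.steadyTsup Dstar Tsafe ∧ D = dc.steadyD Dstar Tsafe)) ∧
      (StrictMonoOn COP R → ∀ (T : Fin n → ℝ) (τ : ℝ) (D : Fin n → ℝ),
        dc.IsOptimal COP R Tsafe Dmax Dstar T τ D →
        (∀ i, 0 < D i ∧ D i < Dmax i) → τ ∈ interior R →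
        T = Tsafe ∧ τ = dc.steadyTsup Dstar Tsafe ∧ D = dc.steadyD Dstar Tsafe)) := by
  refine ⟨fun T₀ τ₀ D₀ _ => DataCenter.exists_isClosedLoopSolution hn hdc Z Tsafe T₀ τ₀ D₀,
    fun Tout Tsup D h hD => ?_, fun hhom => ⟨fun hD hR => ⟨?_, ?_⟩, ?_⟩⟩
  · obtain ⟨C, c, hC, hc, hdecay⟩ := h.exists_energy_le hn hdc hZ hLyap hD
    refine ⟨?_, tendsto_of_norm_sq_le_exp hc fun t ht => (hdecay t ht).1,
      tendsto_of_norm_sq_le_exp hc fun t ht => (hdecay t ht).2.1,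
      tendsto_of_norm_sq_le_exp hc fun t ht => (hdecay t ht).2.2⟩
    refine ((isBounded_image_of_norm_sq_le_exp hC hc fun t ht => (hdecay t ht).1).prod
      ((isBounded_image_of_norm_sq_le_exp hC hc fun t ht => (hdecay t ht).2.1).prod
        (isBounded_image_of_norm_sq_le_exp hC hc fun t ht => (hdecay t ht).2.2))).subset ?_
    rintro _ ⟨t, ht, rfl⟩
    exact ⟨mem_image_of_mem _ ht, mem_image_of_mem _ ht, mem_image_of_mem _ ht⟩
  · exact DataCenter.isOptimal_steady hn hdc hhom hCOP_pos hCOP_mono hD hR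
  · exact fun hCOP hDstar T τ D h => h.eq_steady hn hdc hhom hCOP_pos hCOP hDstar hD hR
  · exact fun hCOP T τ D h hD hR => h.eq_steady_of_inactive hn hdc hhom hCOP_pos hCOP hD hR
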